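/- All notions refer to a separable metrizable space $X$. Let $\mathcal O$ be the collection of open covers of $X$. For a family $\mathcal T$ of subsets of $X$, a $\mathcal T$-cover is an open cover $\mathcal U$ of $X$ such that every $T\in\mathcal T$ is contained in some $U\in\mathcal U$. Let $\mathcal O_{\mathsf{fd}}$ (respectively $\mathcal O_{\mathsf{kfd}}$) be the collection of $\mathcal T$-covers, where $\mathcal T$ consists of all finite dimensional (respectively all compact finite dimensional) subspaces of $X$; dimension is Lebesgue covering dimension. For an ordinal $\alpha$ and collections $\mathcal A,\mathcal B$ of families of subsets of $X$, players ONE and TWO play the games $\mathsf G_1^\alpha(\mathcal A,\mathcal B)$ and $\mathsf G_c^\alpha(\mathcal A,\mathcal B)$, with one inning for each $\gamma<\alpha$. In inning $\gamma$, ONE chooses $A_\gamma\in\mathcal A$. In $\mathsf G_1^\alpha(\mathcal A,\mathcal B)$, TWO responds with some $B_\gamma\in A_\gamma$, and TWO wins the play if $\{B_\gamma:\gamma<\alpha\}\in\mathcal B$. In $\mathsf G_c^\alpha(\mathcal A,\mathcal B)$, TWO responds with a pairwise disjoint family $B_\gamma$ of sets that refines $A_\gamma$ (each member of $B_\gamma$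 is contained in a member of $A_\gamma$), and TWO wins the play if $\bigcup_{\gamma<\alpha}B_\gamma\in\mathcal B$. Let $\mathsf{tp}_{\mathsf S_1(\mathcal A,\mathcal B)}(X)$ and $\mathsf{tp}_{\mathsf S_c(\mathcal A,\mathcal B)}(X)$ be the least $\alpha$ for which TWO has a winning strategy in $\mathsf G_1^\alpha(\mathcal A,\mathcal B)$ and in $\mathsf G_c^\alpha(\mathcal A,\mathcal B)$, respectively. For nonempty $X$, the game dimension $\dim_G(X)$ is the ordinal defined by $1+\dim_G(X)=\mathsf{tp}_{\mathsf S_c(\mathcal O,\mathcal O)}(X)$. **Theorem.** Let $X$ be an infinite dimensional separable metrizable space (that is, $X$ does not have finite covering dimension). Let $\alpha$ be either of the ordinals $\mathsf{tp}_{\mathsf S_1(\mathcal O_{\mathsf{fd}},\mathcal O)}(X)$ and $\mathsf{tp}_{\mathsf S_1(\mathcal O_{\mathsf{kfd}},\mathcal O)}(X)$. Then $$\dim_G(X)\le\begin{cases}\alpha & \text{if }\alpha\text{ is a limit ordinal},\\ \alpha+\omega & \text{otherwise.}\end{cases}$$ -/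

import Mathlib

universe u

namespace GameDimension

/-- The collection `𝒪` of open covers of `X`. -/
def openCovers (X : Type u) [TopologicalSpace X] : Set (Set (Set X)) :=
  {𝒰 | (∀ U ∈ 𝒰, IsOpen U) ∧ ⋃₀ 𝒰 = Set.univ}

/-- The collection `𝒪(𝒯)` of `𝒯`-covers of `X`: open covers `𝒰` such that every `T ∈ 𝒯` is
contained in some single member of `𝒰`. -/
def coversFor {X : Type u} [TopologicalSpace X] (𝒯 : Set (Set X)) : Set (Set (Set X)) :=
  {𝒰 | 𝒰 ∈ openCovers X ∧ ∀ T ∈ 𝒯, ∃ U ∈ 𝒰, T ⊆ U}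

/-- `dim Y ≤ n` for the Lebesgue covering dimension: every finite open cover of `Y` has a finite
open refinement covering `Y` such that no point lies in more than `n + 1` of its members. -/
def CoveringDimLE (Y : Type u) [TopologicalSpace Y] (n : ℕ) : Prop :=
  ∀ 𝒰 ∈ openCovers Y, 𝒰.Finite →
    ∃ 𝒱 ∈ openCovers Y, 𝒱.Finite ∧ (∀ V ∈ 𝒱, ∃ U ∈ 𝒰, V ⊆ U) ∧
      ∀ y : Y, {V | V ∈ 𝒱 ∧ y ∈ V}.ncard ≤ n + 1

/-- `Y` has finite Lebesgue covering dimension. -/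
def FiniteDim (Y : Type u) [TopologicalSpace Y] : Prop :=
  ∃ n : ℕ, CoveringDimLE Y n

/-- `𝒪_fd`: the covers for the family of finite dimensional subspaces of `X`. -/
def fdCovers (X : Type u) [TopologicalSpace X] : Set (Set (Set X)) :=
  coversFor {T : Set X | FiniteDim T}

/-- `𝒪_kfd`: the covers for the family of compact finite dimensional subspaces of `X`. -/
def kfdCovers (X : Type u) [TopologicalSpace X] : Set (Set (Set X)) :=
  coversFor {T : Set X | IsCompact T ∧ FiniteDim T}

/-- TWO has a winning strategy in the game `G_1^α(𝒜, ℬ)`. A strategy `F` assigns to each inning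
`γ` and each sequence of moves of ONE in the innings `β ≤ γ` a response of TWO. It is winning if
in every play of length `α`, in which ONE plays `O γ ∈ 𝒜` in inning `γ < α`, each response is a
member of ONE's last move, and the set of all responses belongs to `ℬ`. -/
def TwoWinsG1 {X : Type u} (𝒜 ℬ : Set (Set (Set X))) (α : Ordinal.{u}) : Prop :=
  ∃ F : (γ : Ordinal.{u}) → (Set.Iic γ → Set (Set X)) → Set X,
    ∀ O : Ordinal.{u} → Set (Set X), (∀ γ < α, O γ ∈ 𝒜) →
      (∀ γ < α, F γ (fun β => O β) ∈ O γ) ∧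
      {B : Set X | ∃ γ < α, B = F γ (fun β => O β)} ∈ ℬ

/-- TWO has a winning strategy in the game `G_c^α(𝒜, ℬ)`. Here each response of TWO has to be a
pairwise disjoint family of sets refining ONE's last move, and TWO wins if the union of all these
families belongs to `ℬ`. -/
def TwoWinsGc {X : Type u} (𝒜 ℬ : Set (Set (Set X))) (α : Ordinal.{u}) : Prop :=
  ∃ F : (γ : Ordinal.{u}) → (Set.Iic γ → Set (Set X)) → Set (Set X),
    ∀ O : Ordinal.{u} → Set (Set X), (∀ γ < α, O γ ∈ 𝒜) →
      (∀ γ < α, (F γ (fun β => O β)).PairwiseDisjoint id ∧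
        ∀ B ∈ F γ (fun β => O β), ∃ A ∈ O γ, B ⊆ A) ∧
      {B : Set X | ∃ γ < α, B ∈ F γ (fun β => O β)} ∈ ℬ

/-- `tp_{S_1(𝒜, ℬ)}(X)`: the least length of the game in which TWO has a winning strategy. -/
noncomputable def tpS1 {X : Type u} (𝒜 ℬ : Set (Set (Set X))) : Ordinal.{u} :=
  sInf {α | TwoWinsG1 𝒜 ℬ α}

/-- `tp_{S_c(𝒜, ℬ)}(X)`: the least length of the game in which TWO has a winning strategy. -/
noncomputable def tpSc {X : Type u} (𝒜 ℬ : Set (Set (Set X))) : Ordinal.{u} :=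
  sInf {α | TwoWinsGc 𝒜 ℬ α}

/-- The game dimension of a nonempty space: the ordinal `δ` with `1 + δ = tp_{S_c(𝒪, 𝒪)}(X)`,
see `one_add_gameDim`. -/
noncomputable def gameDim (X : Type u) [TopologicalSpace X] : Ordinal.{u} :=
  tpSc (openCovers X) (openCovers X) - 1

section WellDefined

variable {X : Type u} [TopologicalSpace X]

/-- A strategy covering the points one by one, along a well-ordering of `X`. -/
theorem exists_pointStrategy (X : Type u) [TopologicalSpace X] :
    ∃ (α : Ordinal.{u}) (F : (γ : Ordinal.{u}) → (Set.Iic γ → Set (Set X)) → Set X),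
      ∀ O : Ordinal.{u} → Set (Set X), (∀ γ < α, O γ ∈ openCovers X) →
        (∀ γ < α, F γ (fun β => O β) ∈ O γ) ∧ ∀ x : X, ∃ γ < α, x ∈ F γ (fun β => O β) := by
  classical
  let r : X → X → Prop := WellOrderingRel
  refine ⟨Ordinal.type r, fun γ P =>
    if h : ∃ (x : X) (U : Set X), Ordinal.typein r x = γ ∧
        U ∈ P ⟨γ, Set.self_mem_Iic⟩ ∧ x ∈ U
      then h.choose_spec.choose else ∅, ?_⟩
  intro O hO
  have key : ∀ x : X, ∃ U ∈ O (Ordinal.typein r x), x ∈ U := fun x => by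
    have h := (hO _ (Ordinal.typein_lt_type r x)).2
    have hx : x ∈ ⋃₀ O (Ordinal.typein r x) := by rw [h]; trivial
    simpa using hx
  have hex : ∀ x : X, ∃ (y : X) (U : Set X), Ordinal.typein r y = Ordinal.typein r x ∧
      U ∈ O (Ordinal.typein r x) ∧ y ∈ U := fun x => by
    obtain ⟨U, hU, hx⟩ := key x
    exact ⟨x, U, rfl, hU, hx⟩
  constructor
  · intro γ hγ
    obtain ⟨x, rfl⟩ := Ordinal.typein_surj r hγ
    beta_reduce
    rw [dif_pos (hex x)]
    exact (hex x).choose_spec.choose_spec.2.1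
  · intro x
    refine ⟨Ordinal.typein r x, Ordinal.typein_lt_type r x, ?_⟩
    beta_reduce
    rw [dif_pos (hex x)]
    have h1 := (hex x).choose_spec.choose_spec.1
    have h2 := (hex x).choose_spec.choose_spec.2.2
    have h3 : (hex x).choose = x := Ordinal.typein_injective r h1
    have aux : ∀ (y : X) (S : Set X), y = x → y ∈ S → x ∈ S := fun y S h h' => by rwa [h] at h'
    exact aux _ _ h3 h2

/-- The minimum defining `tp_{S_1(𝒜, 𝒪)}(X)` exists for any collection `𝒜` of open covers. -/
theorem twoWinsG1_tpS1 {𝒜 : Set (Set (Set X))} (h𝒜 : 𝒜 ⊆ openCovers X) :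
    TwoWinsG1 𝒜 (openCovers X) (tpS1 𝒜 (openCovers X)) := by
  have hne : {α | TwoWinsG1 𝒜 (openCovers X) α}.Nonempty := by
    obtain ⟨α, F, hF⟩ := exists_pointStrategy X
    refine ⟨α, F, fun O hO => ?_⟩
    obtain ⟨h1, h2⟩ := hF O fun γ hγ => h𝒜 (hO γ hγ)
    refine ⟨h1, ?_, Set.eq_univ_of_forall fun x => ?_⟩
    · rintro U ⟨γ, hγ, rfl⟩
      exact (h𝒜 (hO γ hγ)).1 _ (h1 γ hγ)
    · obtain ⟨γ, hγ, hx⟩ := h2 x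
      exact ⟨_, ⟨γ, hγ, rfl⟩, hx⟩
  exact csInf_mem hne

/-- The minimum defining `tp_{S_c(𝒪, 𝒪)}(X)` exists. -/
theorem twoWinsGc_tpSc :
    TwoWinsGc (openCovers X) (openCovers X) (tpSc (openCovers X) (openCovers X)) := by
  have hne : {α | TwoWinsGc (openCovers X) (openCovers X) α}.Nonempty := by
    obtain ⟨α, F, hF⟩ := exists_pointStrategy X
    refine ⟨α, fun γ P => {F γ P}, fun O hO => ?_⟩
    obtain ⟨h1, h2⟩ := hF O hO
    refine ⟨fun γ hγ => ⟨Set.pairwiseDisjoint_singleton _ _, ?_⟩, ?_,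
      Set.eq_univ_of_forall fun x => ?_⟩
    · rintro B rfl
      exact ⟨_, h1 γ hγ, subset_rfl⟩
    · rintro U ⟨γ, hγ, rfl⟩
      exact (hO γ hγ).1 _ (h1 γ hγ)
    · obtain ⟨γ, hγ, hx⟩ := h2 x
      exact ⟨_, ⟨γ, hγ, rfl⟩, hx⟩
  exact csInf_mem hne

/-- The defining equation `1 + dim_G(X) = tp_{S_c(𝒪, 𝒪)}(X)` of the game dimension. -/
theorem one_add_gameDim [Nonempty X] :
    1 + gameDim X = tpSc (openCovers X) (openCovers X) := by
  refine Ordinal.add_sub_cancel_of_le (Order.one_le_iff_pos.2 ?_)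
  refine pos_iff_ne_zero.2 fun h0 => ?_
  obtain ⟨F, hF⟩ := twoWinsGc_tpSc (X := X)
  rw [h0] at hF
  obtain ⟨x⟩ := ‹Nonempty X›
  have h := (hF (fun _ => ∅) fun γ hγ => absurd hγ not_lt_zero).2.2
  have hx : x ∈ (Set.univ : Set X) := trivial
  rw [← h] at hx
  obtain ⟨_, ⟨γ, hγ, _⟩, _⟩ := hx
  exact absurd hγ not_lt_zero

end WellDefined

end GameDimension

namespace GameDimension

/-! ### Finite dimensional sets as finite unions of disjointly coverable sets. -/

section Dimension

/-! A separable metrizable space of dimension at most `n` is a union of `n + 1` zero-dimensional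
sets, and a zero-dimensional subset of `X` can be covered by pairwise disjoint open sets refining
any given open cover of `X` (`FiniteDim.exists_disjointlyCoverable`). So TWO can take care of a
finite dimensional set in finitely many innings of `G_c`.

A winning strategy in `G_1` on `𝒪_fd` dualizes to one that names finite dimensional sets, the
opponent answering with open supersets (`TwoWinsG1.exists_finiteDim_strategy`). Each named set is
spread over a finite block of innings (`exists_disjointlyCoverable_strategy`), and disjoint
refinements covering the pieces are played in `G_c` (`twoWinsGc_of_disjointlyCoverable_strategy`).
Finite blocks do not carry the play past a limit ordinal: innings below `α` fit below any limit `μ ≥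
α`, which is `α` itself if `α` is a limit and `α + ω` otherwise. The compact case reduces to this
one, since ONE has fewer moves in `𝒪_fd` than in `𝒪_kfd`. -/

theorem exists_open_partition {Y : Type u} [TopologicalSpace Y] [NormalSpace Y] {n : ℕ}
    (h : CoveringDimLE Y n) {A B : Fin (n + 1) → Set Y} (hA : ∀ i, IsClosed (A i))
    (hB : ∀ i, IsClosed (B i)) (hAB : ∀ i, Disjoint (A i) (B i)) :
    ∃ P Q : Fin (n + 1) → Set Y, (∀ i, IsOpen (P i)) ∧ (∀ i, IsOpen (Q i)) ∧
      (∀ i, A i ⊆ P i) ∧ (∀ i, B i ⊆ Q i) ∧ (∀ i, Disjoint (P i) (Q i)) ∧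
      ∀ y, ∃ i, y ∈ P i ∨ y ∈ Q i := by
  classical
  -- No `W s` meets both `A i` and `B i`, hence neither does a member of a refinement.
  let W : (Fin (n + 1) → Bool) → Set Y := fun s => ⋂ i, if s i then (A i)ᶜ else (B i)ᶜ
  have hW : Set.range W ∈ openCovers Y := by
    refine ⟨?_, Set.eq_univ_of_forall fun y => ?_⟩
    · rintro _ ⟨s, rfl⟩
      refine isOpen_iInter_of_finite fun i => ?_
      split_ifs
      exacts [(hA i).isOpen_compl, (hB i).isOpen_compl]
    · refine ⟨_, ⟨fun i => decide (y ∉ A i), rfl⟩, Set.mem_iInter.2 fun i => ?_⟩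
      by_cases hy : y ∈ A i
      · simpa [hy] using (hAB i).notMem_of_mem_left hy
      · simp [hy]
  obtain ⟨𝒱, h𝒱, hfin, href, hord⟩ := h _ hW (Set.finite_range W)
  have := hfin.to_subtype
  obtain ⟨K, hKU, hKc, hKs⟩ := exists_iUnion_eq_closed_subset (u := fun V : 𝒱 => (V : Set Y))
    (fun V => h𝒱.1 _ V.2) (fun _ => Set.toFinite _) (by rw [← Set.sUnion_eq_iUnion]; exact h𝒱.2)
  have hsep : ∀ V : 𝒱, ∃ f : C(Y, ℝ), Set.EqOn f 0 (V : Set Y)ᶜ ∧ Set.EqOn f 1 (K V) ∧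
      ∀ x, f x ∈ Set.Icc (0 : ℝ) 1 := fun V =>
    exists_continuous_zero_one_of_isClosed (h𝒱.1 _ V.2).isClosed_compl (hKc V)
      (Set.disjoint_compl_left_iff_subset.2 (hKs V))
  choose f hf0 hf1 _ using hsep
  have hpos : ∀ V y, 0 < f V y → y ∈ (V : Set Y) := fun V y hy => by
    by_contra hyV
    have := hf0 V hyV
    simp only [Pi.zero_apply] at this
    linarith
  have hmiss : ∀ V : 𝒱, ∀ i, ((V : Set Y) ∩ A i).Nonempty → ∀ y ∈ B i, y ∉ (V : Set Y) := by
    rintro V i ⟨x, hxV, hxA⟩ y hyB hyV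
    obtain ⟨_, ⟨s, rfl⟩, hs⟩ := href _ V.2
    have hx := Set.mem_iInter.1 (hs hxV) i
    have hy := Set.mem_iInter.1 (hs hyV) i
    split_ifs at hx hy
    exacts [hx hxA, hy hyB]
  -- The boundary between `P i` and `Q i` lies on the level sets `f V = r i`. Distinct levels in
  -- `(0, 1)` force distinct `V` for distinct `i`.
  let r : Fin (n + 1) → ℝ := fun i => ((i : ℝ) + 1) / (n + 2)
  have hr0 : ∀ i, 0 < r i := fun i => by positivity
  have hr1 : ∀ i, r i < 1 := fun i => by
    have : (i : ℝ) + 1 ≤ n + 1 := by exact_mod_cast i.2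
    refine (div_lt_one (by positivity)).2 (by linarith)
  have hrinj : Function.Injective r := fun i j hij => by
    have h2 : (n : ℝ) + 2 ≠ 0 := by positivity
    have : (i : ℝ) + 1 = j + 1 := (div_left_inj' h2).1 hij
    exact Fin.ext (by exact_mod_cast add_right_cancel this)
  refine ⟨fun i => ⋃ V : {V : 𝒱 // ((V : Set Y) ∩ A i).Nonempty}, {y | r i < f V y},
    fun i => ⋂ V : {V : 𝒱 // ((V : Set Y) ∩ A i).Nonempty}, {y | f V y < r i},
    fun i => isOpen_iUnion fun V => isOpen_lt continuous_const (f V).continuous,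
    fun i => isOpen_iInter_of_finite fun V => isOpen_lt (f V).continuous continuous_const,
    fun i y hy => ?_, fun i y hy => ?_, fun i => ?_, fun y => ?_⟩
  · obtain ⟨V, hV⟩ := Set.mem_iUnion.1 (hKU.symm ▸ Set.mem_univ y : y ∈ ⋃ V, K V)
    refine Set.mem_iUnion.2 ⟨⟨V, y, hKs V hV, hy⟩, ?_⟩
    have := hf1 V hV
    simpa [this] using hr1 i
  · refine Set.mem_iInter.2 fun V => ?_
    have := hf0 V.1 (hmiss V.1 i V.2 y hy)
    simpa [this] using hr0 i
  · refine Set.disjoint_left.2 fun y hP hQ => ?_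
    obtain ⟨V, hV⟩ := Set.mem_iUnion.1 hP
    have hV' : f V y < r i := Set.mem_iInter.1 hQ V
    exact lt_asymm hV hV'
  · by_contra! hcon
    have hex : ∀ i, ∃ V : 𝒱, f V y = r i := fun i => by
      obtain ⟨hP, hQ⟩ := hcon i
      simp only [Set.mem_iUnion, Set.mem_iInter, Set.mem_ofPred_eq, not_exists, not_forall,
        not_lt] at hP hQ
      obtain ⟨V, hV⟩ := hQ
      exact ⟨V, le_antisymm (hP V) hV⟩
    choose v hv using hex
    obtain ⟨V, hV⟩ := Set.mem_iUnion.1 (hKU.symm ▸ Set.mem_univ y : y ∈ ⋃ V, K V)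
    have hV1 : f V y = 1 := hf1 V hV
    -- An uncovered `y` lies in `n + 2` members: one for each level `r i`, and one where the
    -- function is `1`.
    let w : Option (Fin (n + 1)) → Set Y := fun o => (o.elim V v : 𝒱)
    have hval : ∀ o : Option (Fin (n + 1)), f (o.elim V v) y = o.elim 1 r := by
      rintro (_ | i)
      exacts [hV1, hv i]
    have hw : Function.Injective w := by
      intro a b hab
      have hab' : f (a.elim V v) y = f (b.elim V v) y := by rw [Subtype.ext hab]
      rw [hval, hval] at hab'
      rcases a with _ | i <;> rcases b with _ | j
      · rfl
      · exact absurd hab'.symm (hr1 j).ne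
      · exact absurd hab' (hr1 i).ne
      · exact congrArg some (hrinj hab')
    have hsub : Set.range w ⊆ {V | V ∈ 𝒱 ∧ y ∈ V} := by
      rintro _ ⟨o, rfl⟩
      refine ⟨Subtype.property _, hpos _ _ ?_⟩
      rw [hval]
      rcases o with _ | i
      exacts [one_pos, hr0 i]
    have hcard := Set.ncard_le_ncard hsub (hfin.subset fun _ hV => hV.1)
    rw [← Set.image_univ, Set.ncard_image_of_injective _ hw, Set.ncard_univ] at hcard
    have := hord y
    simp only [Nat.card_eq_fintype_card, Fintype.card_option, Fintype.card_fin] at hcard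
    omega

/-- Shrinking the cover makes the closures disjoint, so that they can serve as the closed pairs of a
further application. -/
theorem exists_open_partition_closure {Y : Type u} [TopologicalSpace Y] [NormalSpace Y] {n : ℕ}
    (h : CoveringDimLE Y n) {A B : Fin (n + 1) → Set Y} (hA : ∀ i, IsClosed (A i))
    (hB : ∀ i, IsClosed (B i)) (hAB : ∀ i, Disjoint (A i) (B i)) :
    ∃ P Q : Fin (n + 1) → Set Y, (∀ i, IsOpen (P i)) ∧ (∀ i, IsOpen (Q i)) ∧
      (∀ i, A i ⊆ P i) ∧ (∀ i, B i ⊆ Q i) ∧ (∀ i, Disjoint (closure (P i)) (closure (Q i))) ∧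
      ∀ y, ∃ i, y ∈ P i ∨ y ∈ Q i := by
  obtain ⟨P, Q, hP, hQ, hAP, hBQ, hPQ, hcov⟩ := exists_open_partition h hA hB hAB
  obtain ⟨K, hKU, hKc, hKs⟩ := exists_iUnion_eq_closed_subset (u := Sum.elim P Q)
    (by rintro (i | i); exacts [hP i, hQ i]) (fun _ => Set.toFinite _)
    (Set.eq_univ_of_forall fun y => by
      obtain ⟨i, hi | hi⟩ := hcov y
      exacts [Set.mem_iUnion.2 ⟨.inl i, hi⟩, Set.mem_iUnion.2 ⟨.inr i, hi⟩])
  choose P' hP' hP1 hP2 using fun i => normal_exists_closure_subset ((hA i).union (hKc (.inl i)))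
    (hP i) (Set.union_subset (hAP i) (hKs (.inl i)))
  choose Q' hQ' hQ1 hQ2 using fun i => normal_exists_closure_subset ((hB i).union (hKc (.inr i)))
    (hQ i) (Set.union_subset (hBQ i) (hKs (.inr i)))
  refine ⟨P', Q', hP', hQ', fun i => Set.subset_union_left.trans (hP1 i),
    fun i => Set.subset_union_left.trans (hQ1 i),
    fun i => (hPQ i).mono (hP2 i) (hQ2 i), fun y => ?_⟩
  obtain ⟨i | i, hi⟩ := Set.mem_iUnion.1 (hKU.symm ▸ Set.mem_univ y : y ∈ ⋃ V, K V)
  exacts [⟨i, .inl (hP1 i (.inr hi))⟩, ⟨i, .inr (hQ1 i (.inr hi))⟩]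

/-- There are only countably many tuples `t`. Stage `m` enlarges the pairs indexed by the `m`-th
tuple until they cover `Y`; the sets only grow, with disjoint closures at each stage, so the unions
over all stages stay disjoint and serve every tuple. -/
theorem exists_open_partition_seq {Y : Type u} [TopologicalSpace Y] [NormalSpace Y] {n : ℕ}
    (h : CoveringDimLE Y n) {A B : ℕ → Set Y} (hA : ∀ j, IsClosed (A j))
    (hB : ∀ j, IsClosed (B j)) (hAB : ∀ j, Disjoint (A j) (B j)) :
    ∃ P Q : ℕ → Fin (n + 1) → Set Y, (∀ j i, IsOpen (P j i)) ∧ (∀ j i, IsOpen (Q j i)) ∧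
      (∀ j i, A j ⊆ P j i) ∧ (∀ j i, B j ⊆ Q j i) ∧ (∀ j i, Disjoint (P j i) (Q j i)) ∧
      ∀ (t : Fin (n + 1) → ℕ) (y : Y), ∃ i, y ∈ P (t i) i ∨ y ∈ Q (t i) i := by
  classical
  let S := {s : (ℕ → Fin (n + 1) → Set Y) × (ℕ → Fin (n + 1) → Set Y) //
    ∀ j i, IsOpen (s.1 j i) ∧ IsOpen (s.2 j i) ∧ Disjoint (closure (s.1 j i)) (closure (s.2 j i))}
  have hstep : ∀ (s : S) (t : Fin (n + 1) → ℕ), ∃ s' : S, s.1 ≤ s'.1 ∧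
      ∀ y, ∃ i, y ∈ s'.1.1 (t i) i ∨ y ∈ s'.1.2 (t i) i := by
    rintro ⟨⟨P, Q⟩, hs⟩ t
    obtain ⟨P', Q', hP', hQ', hPP', hQQ', hd, hcov⟩ := exists_open_partition_closure h
      (A := fun i => closure (P (t i) i)) (B := fun i => closure (Q (t i) i))
      (fun _ => isClosed_closure) (fun _ => isClosed_closure) (fun i => (hs (t i) i).2.2)
    refine ⟨⟨(fun j i => if j = t i then P' i else P j i, fun j i => if j = t i then Q' i else Q j i),
      fun j i => ?_⟩, ⟨fun j i => ?_, fun j i => ?_⟩, fun y => ?_⟩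
    · dsimp only
      split_ifs
      exacts [⟨hP' i, hQ' i, hd i⟩, hs j i]
    · dsimp only
      split_ifs with hj
      · subst hj; exact subset_closure.trans (hPP' i)
      · exact le_rfl
    · dsimp only
      split_ifs with hj
      · subst hj; exact subset_closure.trans (hQQ' i)
      · exact le_rfl
    · simpa using hcov y
  choose next hle hnext using hstep
  obtain ⟨e, he⟩ := exists_surjective_nat (Fin (n + 1) → ℕ)
  choose U hU hAU hUB using fun j => normal_exists_closure_subset (hA j) (hB j).isOpen_compl
    (Set.subset_compl_iff_disjoint_right.2 (hAB j))
  choose V hV hBV hVU using fun j => normal_exists_closure_subset (hB j)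
    (isClosed_closure (s := U j)).isOpen_compl
    (Set.subset_compl_comm.1 (hUB j))
  let s : ℕ → S := fun m => Nat.rec ⟨(fun j _ => U j, fun j _ => V j), fun j _ =>
    ⟨hU j, hV j, (Set.subset_compl_iff_disjoint_left.1 (hVU j))⟩⟩ (fun m s => next s (e m)) m
  have hmono : Monotone fun m => (s m).1 := monotone_nat_of_le_succ fun m => hle (s m) (e m)
  refine ⟨fun j i => ⋃ m, (s m).1.1 j i, fun j i => ⋃ m, (s m).1.2 j i,
    fun j i => isOpen_iUnion fun m => ((s m).2 j i).1,
    fun j i => isOpen_iUnion fun m => ((s m).2 j i).2.1,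
    fun j i => (hAU j).trans (Set.subset_iUnion (fun m => (s m).1.1 j i) 0),
    fun j i => (hBV j).trans (Set.subset_iUnion (fun m => (s m).1.2 j i) 0),
    fun j i => Set.disjoint_left.2 fun y hP hQ => ?_, fun t y => ?_⟩
  · obtain ⟨a, ha⟩ := Set.mem_iUnion.1 hP
    obtain ⟨b, hb⟩ := Set.mem_iUnion.1 hQ
    exact Set.disjoint_left.1 ((s (max a b)).2 j i).2.2
      (subset_closure ((hmono (le_max_left a b)).1 j i ha))
      (subset_closure ((hmono (le_max_right a b)).2 j i hb))
  · obtain ⟨m, rfl⟩ := he t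
    obtain ⟨i, hi⟩ := hnext (s m) (e m) y
    exact ⟨i, hi.imp (fun h => Set.mem_iUnion.2 ⟨m + 1, h⟩) fun h => Set.mem_iUnion.2 ⟨m + 1, h⟩⟩

/-- Take the points nearer to `D j` than to the rest of `T`. For `j ≠ k` the rest of `T` contains `D
k`, so a common point would be strictly nearer to each of `D j`, `D k` than to the other. -/
theorem exists_disjoint_open_extension {X ι : Type*} [TopologicalSpace X]
    [TopologicalSpace.MetrizableSpace X] {T : Set X} {D : ι → Set T} (hD : ∀ j, IsOpen (D j))
    (hdisj : Pairwise fun j k => Disjoint (D j) (D k)) :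
    ∃ E : ι → Set X, (∀ j, IsOpen (E j)) ∧ (Pairwise fun j k => Disjoint (E j) (E k)) ∧
      ∀ j, Subtype.val '' D j ⊆ E j := by
  let _ := TopologicalSpace.metrizableSpaceMetric X
  refine ⟨fun j => {y | Metric.infEDist y (Subtype.val '' D j) <
      Metric.infEDist y (Subtype.val '' (D j)ᶜ)},
    fun j => isOpen_lt Metric.continuous_infEDist Metric.continuous_infEDist,
    fun j k hjk => Set.disjoint_left.2 fun y hj hk => ?_, fun j => ?_⟩
  · have h1 : Metric.infEDist y (Subtype.val '' (D j)ᶜ) ≤ Metric.infEDist y (Subtype.val '' D k) :=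
      Metric.infEDist_anti (Set.image_mono (hdisj hjk).subset_compl_left)
    have h2 : Metric.infEDist y (Subtype.val '' (D k)ᶜ) ≤ Metric.infEDist y (Subtype.val '' D j) :=
      Metric.infEDist_anti (Set.image_mono (hdisj hjk).subset_compl_right)
    exact lt_irrefl _ ((hj.trans_le h1).trans (hk.trans_le h2))
  · rintro _ ⟨x, hx, rfl⟩
    have h0 : Metric.infEDist (x : X) (Subtype.val '' D j) = 0 :=
      Metric.infEDist_zero_of_mem ⟨x, hx, rfl⟩
    rw [Set.mem_ofPred_eq, h0, pos_iff_ne_zero]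
    intro h
    rw [← Metric.mem_closure_iff_infEDist_zero] at h
    rw [← closure_subtype, (hD j).isClosed_compl.closure_eq] at h
    exact h hx

/-- Every open cover of `X` has a pairwise disjoint open partial refinement covering `Z`. -/
def DisjointlyCoverable {X : Type u} [TopologicalSpace X] (Z : Set X) : Prop :=
  ∀ 𝒪 ∈ openCovers X, ∃ ℬ : Set (Set X), (∀ B ∈ ℬ, IsOpen B) ∧ ℬ.PairwiseDisjoint id ∧
    (∀ B ∈ ℬ, ∃ A ∈ 𝒪, B ⊆ A) ∧ Z ⊆ ⋃₀ ℬ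

/-- Pairs of basic sets with the closure of one inside the other; the pair `(∅, ∅)` only ensures
that there is something to enumerate. -/
theorem exists_separating_seq (Y : Type u) [TopologicalSpace Y] [RegularSpace Y]
    [SecondCountableTopology Y] :
    ∃ A V : ℕ → Set Y, (∀ j, IsClosed (A j)) ∧ (∀ j, IsOpen (V j)) ∧ (∀ j, A j ⊆ V j) ∧
      ∀ (y : Y) (W : Set Y), IsOpen W → y ∈ W → ∃ j, y ∈ A j ∧ V j ⊆ W := by
  let b := TopologicalSpace.countableBasis Y
  have hb := TopologicalSpace.isBasis_countableBasis Y
  let p : Set (Set Y × Set Y) := insert (∅, ∅) {q ∈ b ×ˢ b | closure q.1 ⊆ q.2}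
  have hp : p.Countable := (((TopologicalSpace.countable_countableBasis Y).prod
    (TopologicalSpace.countable_countableBasis Y)).mono (Set.sep_subset _ _)).insert _
  obtain ⟨f, hf⟩ := hp.exists_eq_range (Set.insert_nonempty _ _)
  have hfp : ∀ j, f j ∈ p := fun j => hf ▸ Set.mem_range_self j
  refine ⟨fun j => closure (f j).1, fun j => (f j).2, fun _ => isClosed_closure, fun j => ?_,
    fun j => ?_, fun y W hW hy => ?_⟩
  · rcases hfp j with h | h
    · simp [h]
    · exact hb.isOpen h.1.2
  · rcases hfp j with h | h
    · simp [h]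
    · exact h.2
  · obtain ⟨V, hV, hyV, hVW⟩ := hb.exists_subset_of_mem_open hy hW
    obtain ⟨C, hC, hCc, hCV⟩ := exists_mem_nhds_isClosed_subset ((hb.isOpen hV).mem_nhds hyV)
    obtain ⟨U, hU, hyU, hUC⟩ := hb.mem_nhds_iff.1 hC
    have : (U, V) ∈ p := .inr ⟨⟨hU, hV⟩, (closure_minimal hUC hCc).trans hCV⟩
    rw [hf] at this
    obtain ⟨j, hj⟩ := this
    exact ⟨j, by simpa [hj] using subset_closure hyU, by simpa [hj] using hVW⟩

/-- `Z i` consists of the points that no partition `(P j i, Q j i)` misses. On it the sets `P j i`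
are clopen and form a base, since `A j ⊆ P j i ⊆ V j`. A point outside every `Z i` would give a
tuple `t` of partitions all missing it. -/
theorem FiniteDim.exists_disjointlyCoverable {X : Type u} [TopologicalSpace X]
    [TopologicalSpace.MetrizableSpace X] [TopologicalSpace.SeparableSpace X] {T : Set X}
    (hT : FiniteDim T) :
    ∃ (n : ℕ) (Z : ℕ → Set X), (∀ i, DisjointlyCoverable (Z i)) ∧
      ∀ x ∈ T, ∃ i < n + 1, x ∈ Z i := by
  classical
  let _ := TopologicalSpace.metrizableSpaceMetric X
  have := UniformSpace.secondCountable_of_separable X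
  obtain ⟨n, hn⟩ := hT
  obtain ⟨A, V, hA, hV, hAV, hbase⟩ := exists_separating_seq T
  obtain ⟨P, Q, hP, hQ, hAP, hVQ, hPQ, hcov⟩ := exists_open_partition_seq hn hA
    (fun j => (hV j).isClosed_compl) (fun j => Set.disjoint_compl_right_iff_subset.2 (hAV j))
  let Z : Fin (n + 1) → Set T := fun i => {y | ∀ j, y ∈ P j i ∨ y ∈ Q j i}
  have hempty : DisjointlyCoverable (∅ : Set X) := fun _ _ =>
    ⟨∅, by simp, Set.pairwiseDisjoint_empty, by simp, Set.empty_subset _⟩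
  have hZ : ∀ i, DisjointlyCoverable (Subtype.val '' Z i) := by
    intro i 𝒪 h𝒪
    let J : Set ℕ := {j | ∃ W ∈ 𝒪, Subtype.val '' V j ⊆ W}
    -- Disjointification by first index: a point of `Z i` outside `P k i` is in `Q k i`, so the
    -- least `j ∈ J` with `y ∈ P j i` puts `y` in `D j`.
    let D : J → Set T := fun j => P j i ∩ ⋂ k : {k : J // k < j}, Q k i
    have hDo : ∀ j, IsOpen (D j) := fun j => by
      have : Finite {k : J // k < j} := by
        refine Finite.of_injective (β := Fin j.1) (fun k => ⟨k.1.1, k.2⟩) fun a b hab => ?_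
        exact Subtype.ext (Subtype.ext (by simpa using hab))
      exact (hP j i).inter (isOpen_iInter_of_finite fun k => hQ k i)
    have hlt : ∀ j k : J, j < k → Disjoint (D j) (D k) := fun j k hjk =>
      Set.disjoint_left.2 fun y hy hy' =>
        Set.disjoint_left.1 (hPQ j i) hy.1 (Set.mem_iInter.1 hy'.2 ⟨j, hjk⟩)
    obtain ⟨E, hE, hEd, hDE⟩ := exists_disjoint_open_extension hDo fun j k hjk =>
      (lt_or_gt_of_ne hjk).elim (hlt j k) fun h => (hlt k j h).symm
    choose W hW hVW using fun j : J => j.2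
    refine ⟨Set.range fun j => E j ∩ W j, ?_, ?_, ?_, ?_⟩
    · rintro _ ⟨j, rfl⟩
      exact (hE j).inter (h𝒪.1 _ (hW j))
    · rintro _ ⟨j, rfl⟩ _ ⟨k, rfl⟩ hjk
      exact (hEd fun h => hjk (by rw [h])).mono Set.inter_subset_left Set.inter_subset_left
    · rintro _ ⟨j, rfl⟩
      exact ⟨W j, hW j, Set.inter_subset_right⟩
    · rintro _ ⟨y, hy, rfl⟩
      have hPV : ∀ j, P j i ⊆ V j := fun j x hx => by
        by_contra hxV
        exact Set.disjoint_left.1 (hPQ j i) hx (hVQ j i hxV)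
      have hex : ∃ j, ∃ h : j ∈ J, y ∈ P j i := by
        have hy' : (y : X) ∈ ⋃₀ 𝒪 := h𝒪.2.symm ▸ Set.mem_univ _
        obtain ⟨O, hO, hyO⟩ := hy'
        obtain ⟨j, hj, hjO⟩ := hbase y (Subtype.val ⁻¹' O)
          ((h𝒪.1 _ hO).preimage continuous_subtype_val) hyO
        exact ⟨j, ⟨O, hO, Set.image_subset_iff.2 hjO⟩, hAP j i hj⟩
      obtain ⟨hJ, hyP⟩ := Nat.find_spec hex
      have hyD : y ∈ D ⟨Nat.find hex, hJ⟩ := by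
        refine ⟨hyP, Set.mem_iInter.2 fun k => (hy k.1.1).resolve_left fun hk => ?_⟩
        exact Nat.find_min hex k.2 ⟨k.1.2, hk⟩
      exact ⟨_, ⟨⟨Nat.find hex, hJ⟩, rfl⟩, hDE _ ⟨y, hyD, rfl⟩, hVW _ ⟨y, hPV _ hyP, rfl⟩⟩
  refine ⟨n, fun i => if h : i < n + 1 then Subtype.val '' Z ⟨i, h⟩ else ∅, fun i => ?_,
    fun x hx => ?_⟩
  · dsimp only
    split_ifs
    exacts [hZ _, hempty]
  · by_contra! hcon
    have hex : ∀ i : Fin (n + 1), ∃ j, ¬ ((⟨x, hx⟩ : T) ∈ P j i ∨ (⟨x, hx⟩ : T) ∈ Q j i) := by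
      intro i
      by_contra! hi
      refine hcon i i.2 ?_
      rw [dif_pos i.2]
      exact ⟨⟨x, hx⟩, hi, rfl⟩
    choose t ht using hex
    obtain ⟨i, hi⟩ := hcov t ⟨x, hx⟩
    exact ht i hi

end Dimension

end GameDimension
namespace GameDimension

/-! ### Translating strategies between the games. -/

section Game

/-- The value of `g` at `(γ, f)` depends only on the values of `f` below `γ`. -/
def DependsOnPast {S R : Type*} (g : Ordinal.{u} → (Ordinal.{u} → S) → R) : Prop :=
  ∀ (γ : Ordinal.{u}) (f f' : Ordinal.{u} → S), (∀ β < γ, f β = f' β) → g γ f = g γ f'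

theorem DependsOnPast.exists_fixed {S : Type*} [Nonempty S]
    {g : Ordinal.{u} → (Ordinal.{u} → S) → S} (hg : DependsOnPast g) :
    ∃ f : Ordinal.{u} → S, ∀ γ, f γ = g γ f := by
  classical
  obtain ⟨d⟩ := ‹Nonempty S›
  let f : Ordinal.{u} → S := WellFounded.fix (r := ((· < ·) : Ordinal.{u} → Ordinal.{u} → Prop))
    wellFounded_lt fun γ h => g γ fun β => if hβ : β < γ then h β hβ else d
  refine ⟨f, fun γ => ?_⟩
  have : f γ = g γ fun β => if β < γ then f β else d := by
    simp only [f]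
    rw [WellFounded.fix_eq]
    simp
  rw [this]
  exact hg _ _ _ fun β hβ => if_pos hβ

theorem FiniteDim.of_subsingleton {Y : Type u} [TopologicalSpace Y] [Subsingleton Y] :
    FiniteDim Y := by
  refine ⟨0, fun 𝒰 h𝒰 hfin => ⟨𝒰 ∩ {Set.univ}, ⟨fun V hV => h𝒰.1 V hV.1,
    Set.eq_univ_of_forall fun y => ?_⟩, hfin.inter_of_left _, fun V hV => ⟨V, hV.1, le_rfl⟩,
    fun y => ?_⟩⟩
  · obtain ⟨U, hU, hy⟩ : y ∈ ⋃₀ 𝒰 := h𝒰.2.symm ▸ Set.mem_univ y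
    exact ⟨U, ⟨hU, Subsingleton.eq_univ_of_nonempty ⟨y, hy⟩⟩, hy⟩
  · refine (Set.ncard_le_ncard (t := {Set.univ}) (fun V hV => hV.1.2)
      (Set.finite_singleton _)).trans ?_
    simp

theorem univ_mem_fdCovers (X : Type u) [TopologicalSpace X] :
    {Set.univ} ∈ fdCovers X :=
  ⟨⟨by simp, by simp⟩, fun T _ => ⟨Set.univ, rfl, Set.subset_univ T⟩⟩

/-- A winning strategy of TWO in `G_1^α(𝒪_fd, 𝒪)` yields one for the player who names finite
dimensional sets while the opponent answers with open sets containing them. -/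
theorem TwoWinsG1.exists_finiteDim_strategy {X : Type u} [TopologicalSpace X] {α : Ordinal.{u}}
    (h : TwoWinsG1 (fdCovers X) (openCovers X) α) :
    ∃ Φ : Ordinal.{u} → (Ordinal.{u} → Set X) → Set X, (∀ γ U, FiniteDim (Φ γ U)) ∧
      DependsOnPast Φ ∧ ∀ U : Ordinal.{u} → Set X,
        (∀ γ < α, IsOpen (U γ) ∧ Φ γ U ⊆ U γ) → ∀ x, ∃ γ < α, x ∈ U γ := by
  classical
  obtain ⟨F, hF⟩ := h
  -- If every `T` had an open superset `U T` containing no response, ONE could play the cover of all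
  -- `U T`, and the response would be some `U T` itself.
  have hT : ∀ (γ : Ordinal.{u}) (A : Ordinal.{u} → Set (Set X)), ∃ T : Set X, FiniteDim T ∧
      (γ < α → (∀ β, A β ∈ fdCovers X) → ∀ U, IsOpen U → T ⊆ U →
        ∃ C ∈ fdCovers X, F γ (fun β => Function.update A γ C β) ⊆ U) := by
    intro γ A
    by_contra! hcon
    obtain ⟨hγ, hA, -⟩ := hcon ∅ FiniteDim.of_subsingleton
    choose U hU hTU hUF using fun T : {T : Set X // FiniteDim T} => (hcon T.1 T.2).2.2
    have hC : Set.range U ∈ fdCovers X := by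
      refine ⟨⟨by rintro _ ⟨T, rfl⟩; exact hU T, Set.eq_univ_of_forall fun x => ?_⟩,
        fun T hT => ⟨_, ⟨⟨T, hT⟩, rfl⟩, hTU ⟨T, hT⟩⟩⟩
      exact ⟨_, ⟨⟨{x}, FiniteDim.of_subsingleton⟩, rfl⟩, hTU ⟨{x}, _⟩ rfl⟩
    have hmem := (hF (Function.update A γ (Set.range U)) fun β _ => by
      by_cases hβ : β = γ
      · subst hβ; simpa using hC
      · simpa [hβ] using hA β).1 γ hγ
    rw [Function.update_self] at hmem
    obtain ⟨T, hT⟩ := hmem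
    exact hUF T _ hC hT.ge
  choose Tf hTf hTF using hT
  -- Moves from inning `γ` on are replaced by the legal cover `{univ}`, so that the named set
  -- depends on the past only.
  let trunc : Ordinal.{u} → (Ordinal.{u} → Set (Set X)) → Ordinal.{u} → Set (Set X) :=
    fun γ A β => if β < γ then A β else {Set.univ}
  have htrunc : DependsOnPast trunc := fun γ A A' hAA' => by
    funext β
    by_cases hβ : β < γ
    · simp [trunc, hβ, hAA' β hβ]
    · simp [trunc, hβ]
  -- The simulated move of ONE: a cover to which `F` responds inside `U γ`.
  let step : (Ordinal.{u} → Set X) → Ordinal.{u} → (Ordinal.{u} → Set (Set X)) → Set (Set X) :=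
    fun U γ A => if hC : ∃ C ∈ fdCovers X,
      F γ (fun β => Function.update (trunc γ A) γ C β) ⊆ U γ then hC.choose else {Set.univ}
  choose A hA using fun U => DependsOnPast.exists_fixed (g := step U) fun γ A A' hAA' => by
    simp only [step, htrunc γ A A' hAA']
  have hAfd : ∀ U γ, A U γ ∈ fdCovers X := fun U γ => by
    rw [hA]
    simp only [step]
    split_ifs with hC
    exacts [hC.choose_spec.1, univ_mem_fdCovers X]
  have htfd : ∀ U γ β, trunc γ (A U) β ∈ fdCovers X := fun U γ β => by
    simp only [trunc]
    split_ifs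
    exacts [hAfd U β, univ_mem_fdCovers X]
  have hAloc : ∀ (γ : Ordinal.{u}) (U U' : Ordinal.{u} → Set X), (∀ β < γ, U β = U' β) →
      ∀ β < γ, A U β = A U' β := by
    intro γ U U' hUU' β
    induction β using WellFoundedLT.induction with
    | ind β ih =>
      intro hβ
      rw [hA U, hA U']
      simp only [step, hUU' β hβ,
        htrunc β (A U) (A U') fun β' h' => ih β' h' (h'.trans hβ)]
  refine ⟨fun γ U => Tf γ (trunc γ (A U)), fun _ _ => hTf _ _, fun γ U U' hUU' => ?_,
    fun U hU x => ?_⟩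
  · simp only [htrunc γ (A U) (A U') (hAloc γ U U' hUU')]
  · have hsub : ∀ γ < α, F γ (fun β => A U β) ⊆ U γ := fun γ hγ => by
      have hC := hTF γ _ hγ (htfd U γ) (U γ) (hU γ hγ).1 (hU γ hγ).2
      have h1 := hC.choose_spec.2
      have h2 : A U γ = hC.choose := by
        conv_lhs => rw [hA]
        simp only [step]
        rw [dif_pos hC]
      rw [← h2] at h1
      convert h1 using 3 with β
      by_cases hβ : (β : Ordinal.{u}) = γ
      · simp [hβ]
      · simp [hβ, trunc, lt_of_le_of_ne β.2 hβ]
    have hx : x ∈ ⋃₀ {B : Set X | ∃ γ < α, B = F γ (fun β => A U β)} :=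
      (hF (A U) fun γ _ => hAfd U γ).2.2.symm ▸ Set.mem_univ x
    obtain ⟨_, ⟨γ, hγ, rfl⟩, hx⟩ := hx
    exact ⟨γ, hγ, hsub γ hγ hx⟩

/-- A finite dimensional set can be replaced by a finite block of disjointly coverable sets. -/
theorem exists_disjointlyCoverable_strategy {X : Type u} [TopologicalSpace X]
    [TopologicalSpace.MetrizableSpace X] [TopologicalSpace.SeparableSpace X] {α μ : Ordinal.{u}}
    (hμ : Order.IsSuccLimit μ) (hαμ : α ≤ μ)
    {Φ : Ordinal.{u} → (Ordinal.{u} → Set X) → Set X} (hΦ : ∀ γ U, FiniteDim (Φ γ U))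
    (hloc : DependsOnPast Φ) (hwin : ∀ U : Ordinal.{u} → Set X,
        (∀ γ < α, IsOpen (U γ) ∧ Φ γ U ⊆ U γ) → ∀ x, ∃ γ < α, x ∈ U γ) :
    ∃ Ψ : Ordinal.{u} → (Ordinal.{u} → Set X) → Set X, (∀ δ V, DisjointlyCoverable (Ψ δ V)) ∧
      DependsOnPast Ψ ∧ ∀ V : Ordinal.{u} → Set X,
        (∀ δ < μ, IsOpen (V δ) ∧ Ψ δ V ⊆ V δ) → ∀ x, ∃ δ < μ, x ∈ V δ := by
  classical
  have hlen : ∀ T : Set X, ∃ (n : ℕ) (Z : ℕ → Set X), (∀ i, DisjointlyCoverable (Z i)) ∧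
      (FiniteDim T → ∀ x ∈ T, ∃ i < n + 1, x ∈ Z i) := by
    intro T
    by_cases hT : FiniteDim T
    · obtain ⟨n, Z, h1, h2⟩ := hT.exists_disjointlyCoverable
      exact ⟨n, Z, h1, fun _ => h2⟩
    · exact ⟨0, fun _ => ∅, fun _ _ _ => ⟨∅, by simp, Set.pairwiseDisjoint_empty, by simp,
        Set.empty_subset _⟩, fun h => absurd h hT⟩
  choose len Z hZ hTZ using hlen
  -- Block `γ` starts at `s γ` and has `len + 1` innings; the union of the answers given there is
  -- the answer `U γ` to `Φ`. The length depends on earlier answers, so `s` and `U` are built by one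
  -- recursion.
  have hblocks : ∀ V : Ordinal.{u} → Set X, ∃ (s : Ordinal.{u} → Ordinal.{u})
      (U : Ordinal.{u} → Set X),
      (∀ γ, s γ = ⨆ β : Set.Iio γ, (s β + (len (Φ β U) + 1 : ℕ))) ∧
      ∀ γ, U γ = ⋃ i < len (Φ γ U) + 1, V (s γ + (i : ℕ)) := by
    intro V
    obtain ⟨f, hf⟩ := DependsOnPast.exists_fixed (S := Ordinal.{u} × Set X)
      (g := fun γ f =>
        (⨆ β : Set.Iio γ, ((f β).1 + (len (Φ β fun β => (f β).2) + 1 : ℕ)),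
          ⋃ i < len (Φ γ fun β => (f β).2) + 1,
            V ((⨆ β : Set.Iio γ, ((f β).1 + (len (Φ β fun β => (f β).2) + 1 : ℕ))) + (i : ℕ)))) <| by
      intro γ f f' hff'
      have h1 : Φ γ (fun β => (f β).2) = Φ γ fun β => (f' β).2 :=
        hloc _ _ _ fun β hβ => by rw [hff' β hβ]
      have h2 : ∀ β : Set.Iio γ, (f β).1 + ((len (Φ β fun β => (f β).2) + 1 : ℕ) : Ordinal.{u}) =
          (f' β).1 + (len (Φ β fun β => (f' β).2) + 1 : ℕ) := fun β => by
        rw [hff' β β.2, hloc β (fun β => (f β).2) (fun β => (f' β).2) fun β' h' => by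
          rw [hff' β' (h'.trans β.2)]]
      simp only [h1, h2]
    refine ⟨fun γ => (f γ).1, fun γ => (f γ).2, fun γ => ?_, fun γ => ?_⟩
    · exact congrArg Prod.fst (hf γ)
    · have e1 := congrArg Prod.fst (hf γ)
      have e2 := congrArg Prod.snd (hf γ)
      dsimp only at e1 e2 ⊢
      rw [e1]
      exact e2
  choose s U hs hU using hblocks
  have hend : ∀ V γ β, β < γ → s V β + (len (Φ β (U V)) + 1 : ℕ) ≤ s V γ := fun V γ β hβ => by
    rw [hs V γ]
    exact Ordinal.le_iSup (fun β : Set.Iio γ => s V β + ((len (Φ β (U V)) + 1 : ℕ) : Ordinal.{u}))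
      ⟨β, hβ⟩
  have hpos : ∀ V γ (i : ℕ), i < len (Φ γ (U V)) + 1 →
      s V γ + (i : Ordinal.{u}) < s V γ + (len (Φ γ (U V)) + 1 : ℕ) := fun V γ i hi => by
    gcongr
  have hmono : ∀ V, StrictMono (s V) := fun V β γ hβ => lt_of_lt_of_le (by simp) (hend V γ β hβ)
  have huniq : ∀ V γ γ' (i i' : ℕ), i < len (Φ γ (U V)) + 1 → i' < len (Φ γ' (U V)) + 1 →
      s V γ + (i : Ordinal.{u}) = s V γ' + (i' : Ordinal.{u}) → γ = γ' ∧ i = i' := by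
    have hlt : ∀ V γ γ' (i i' : ℕ), i < len (Φ γ (U V)) + 1 → γ < γ' →
        s V γ + (i : Ordinal.{u}) ≠ s V γ' + (i' : Ordinal.{u}) := fun V γ γ' i i' hi hγ =>
      ((hpos V γ i hi).trans_le ((hend V γ' γ hγ).trans le_self_add)).ne
    intro V γ γ' i i' hi hi' heq
    rcases lt_trichotomy γ γ' with h | rfl | h
    · exact absurd heq (hlt V γ γ' i i' hi h)
    · exact ⟨rfl, by exact_mod_cast add_left_cancel heq⟩
    · exact absurd heq.symm (hlt V γ' γ i' i hi' h)
  -- When block `γ` starts no later than `δ`, all earlier blocks end by `δ`, so the moves before `δ`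
  -- determine its start and its named set.
  have hpast : ∀ (V V' : Ordinal.{u} → Set X) (δ : Ordinal.{u}), (∀ β < δ, V β = V' β) →
      ∀ γ, s V γ ≤ δ → s V γ = s V' γ ∧ Φ γ (U V) = Φ γ (U V') := by
    intro V V' δ hVV' γ
    induction γ using WellFoundedLT.induction with
    | ind γ ih =>
      intro hγ
      have ih' : ∀ β < γ, s V β = s V' β ∧ Φ β (U V) = Φ β (U V') := fun β hβ =>
        ih β hβ ((hmono V hβ).le.trans hγ)
      refine ⟨?_, hloc _ _ _ fun β hβ => ?_⟩
      · rw [hs V, hs V']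
        exact iSup_congr fun β => by rw [(ih' β β.2).1, (ih' β β.2).2]
      · rw [hU V, hU V', ← (ih' β hβ).1, ← (ih' β hβ).2]
        refine Set.iUnion₂_congr fun i hi => hVV' _ ?_
        exact (hpos V β i hi).trans_le ((hend V γ β hβ).trans hγ)
  -- At a limit `γ`, earlier blocks end below `γ`, so `s γ ≤ γ`; otherwise the preceding block ends
  -- below `ν`. Adding a finite length stays below the limit `ν`.
  have hbound : ∀ V γ ν, Order.IsSuccLimit ν → γ < ν →
      s V γ + (len (Φ γ (U V)) + 1 : ℕ) < ν := by
    intro V γ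
    induction γ using WellFoundedLT.induction with
    | ind γ ih =>
      intro ν hν hγ
      have hsγ : s V γ < ν := by
        rcases Ordinal.zero_or_succ_or_isSuccLimit γ with rfl | ⟨β, rfl⟩ | hlim
        · rw [hs]
          refine lt_of_le_of_lt (Ordinal.iSup_le fun β => ?_) hγ
          exact absurd (Set.mem_Iio.1 β.2) not_lt_zero
        · refine lt_of_le_of_lt ?_ (ih β (Order.lt_succ β) ν hν ((Order.lt_succ β).trans hγ))
          rw [hs]
          refine Ordinal.iSup_le fun β' => ?_
          rcases (Order.lt_succ_iff.1 (Set.mem_Iio.1 β'.2)).lt_or_eq with h | h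
          · exact (hend V β β' h).trans le_self_add
          · rw [h]
        · refine lt_of_le_of_lt ?_ hγ
          rw [hs]
          exact Ordinal.iSup_le fun β => (ih β β.2 γ hlim β.2).le
      exact hν.add_natCast_lt hsγ _
  let Ψ : Ordinal.{u} → (Ordinal.{u} → Set X) → Set X := fun δ V =>
    {x | ∃ (γ : Ordinal.{u}) (i : ℕ), i < len (Φ γ (U V)) + 1 ∧ s V γ + (i : Ordinal.{u}) = δ ∧
      x ∈ Z (Φ γ (U V)) i}
  have hΨ : ∀ V γ (i : ℕ), i < len (Φ γ (U V)) + 1 →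
      Ψ (s V γ + (i : Ordinal.{u})) V = Z (Φ γ (U V)) i := by
    intro V γ i hi
    ext x
    constructor
    · rintro ⟨γ', i', hi', heq, hx⟩
      obtain ⟨rfl, rfl⟩ := huniq V _ _ _ _ hi' hi heq
      exact hx
    · exact fun hx => ⟨γ, i, hi, rfl, hx⟩
  have hΨsub : ∀ δ V V', (∀ β < δ, V β = V' β) → Ψ δ V ⊆ Ψ δ V' := by
    rintro δ V V' hVV' x ⟨γ, i, hi, hδ, hx⟩
    obtain ⟨h1, h2⟩ := hpast V V' δ hVV' γ (hδ ▸ le_self_add)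
    exact ⟨γ, i, h2 ▸ hi, h1 ▸ hδ, h2 ▸ hx⟩
  refine ⟨Ψ, fun δ V => ?_, fun δ V V' hVV' => (hΨsub δ V V' hVV').antisymm
    (hΨsub δ V' V fun β hβ => (hVV' β hβ).symm), fun V hV x => ?_⟩
  · by_cases h : ∃ (γ : Ordinal.{u}) (i : ℕ), i < len (Φ γ (U V)) + 1 ∧
        s V γ + (i : Ordinal.{u}) = δ
    · obtain ⟨γ, i, hi, rfl⟩ := h
      rw [hΨ V γ i hi]
      exact hZ _ _
    · intro 𝒪 _
      refine ⟨∅, by simp, Set.pairwiseDisjoint_empty, by simp, ?_⟩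
      rintro x ⟨γ, i, hi, hδ, -⟩
      exact absurd ⟨γ, i, hi, hδ⟩ h
  · have hlt : ∀ γ < α, ∀ i < len (Φ γ (U V)) + 1, s V γ + (i : Ordinal.{u}) < μ :=
      fun γ hγ i hi => (hpos V γ i hi).trans (hbound V γ μ hμ (hγ.trans_le hαμ))
    obtain ⟨γ, hγ, hx⟩ := hwin (U V) (fun γ hγ => by
      rw [hU V γ]
      refine ⟨isOpen_iUnion fun i => isOpen_iUnion fun hi => (hV _ (hlt γ hγ i hi)).1,
        fun y hy => ?_⟩
      obtain ⟨i, hi, hyi⟩ := hTZ _ (hΦ γ (U V)) y hy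
      exact Set.mem_iUnion₂.2 ⟨i, hi, (hV _ (hlt γ hγ i hi)).2 ((hΨ V γ i hi).symm ▸ hyi)⟩) x
    rw [hU V γ] at hx
    obtain ⟨i, hi, hx⟩ := Set.mem_iUnion₂.1 hx
    exact ⟨_, hlt γ hγ i hi, hx⟩

/-- TWO answers `O δ` by a disjoint open refinement covering the set named by `Ψ`; the union of this
family is fed back to `Ψ` as the opponent's answer. -/
theorem twoWinsGc_of_disjointlyCoverable_strategy {X : Type u} [TopologicalSpace X]
    {μ : Ordinal.{u}} {Ψ : Ordinal.{u} → (Ordinal.{u} → Set X) → Set X}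
    (hΨ : ∀ δ V, DisjointlyCoverable (Ψ δ V)) (hloc : DependsOnPast Ψ)
    (hwin : ∀ V : Ordinal.{u} → Set X,
      (∀ δ < μ, IsOpen (V δ) ∧ Ψ δ V ⊆ V δ) → ∀ x, ∃ δ < μ, x ∈ V δ) :
    TwoWinsGc (openCovers X) (openCovers X) μ := by
  classical
  have hH : ∀ (Z : Set X) (𝒪 : Set (Set X)), ∃ ℬ : Set (Set X), DisjointlyCoverable Z →
      𝒪 ∈ openCovers X → (∀ B ∈ ℬ, IsOpen B) ∧ ℬ.PairwiseDisjoint id ∧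
        (∀ B ∈ ℬ, ∃ A ∈ 𝒪, B ⊆ A) ∧ Z ⊆ ⋃₀ ℬ := by
    intro Z 𝒪
    by_cases h : DisjointlyCoverable Z ∧ 𝒪 ∈ openCovers X
    · obtain ⟨ℬ, hℬ⟩ := h.1 𝒪 h.2
      exact ⟨ℬ, fun _ _ => hℬ⟩
    · exact ⟨∅, fun h1 h2 => absurd ⟨h1, h2⟩ h⟩
  choose H hH using hH
  choose V hV using fun O : Ordinal.{u} → Set (Set X) => DependsOnPast.exists_fixed
    (g := fun δ V => ⋃₀ H (Ψ δ V) (O δ)) fun δ V V' hVV' => by simp only [hloc δ V V' hVV']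
  have hpast : ∀ (O O' : Ordinal.{u} → Set (Set X)) (δ : Ordinal.{u}), (∀ β < δ, O β = O' β) →
      ∀ β < δ, V O β = V O' β := by
    intro O O' δ hOO' β
    induction β using WellFoundedLT.induction with
    | ind β ih =>
      intro hβ
      rw [hV O, hV O', hOO' β hβ, hloc β (V O) (V O') fun β' h' => ih β' h' (h'.trans hβ)]
  -- The value `∅` after inning `δ` is harmless, as `Ψ δ` sees only answers to earlier innings.
  let ext : (δ : Ordinal.{u}) → (Set.Iic δ → Set (Set X)) → Ordinal.{u} → Set (Set X) :=
    fun δ p β => if h : β ≤ δ then p ⟨β, h⟩ else ∅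
  refine ⟨fun δ p => H (Ψ δ (V (ext δ p))) (p ⟨δ, Set.self_mem_Iic⟩), fun O hO => ?_⟩
  have hresp : ∀ δ, Ψ δ (V (ext δ fun β => O β)) = Ψ δ (V O) := fun δ =>
    hloc _ _ _ (hpast _ _ δ fun β hβ => dif_pos hβ.le)
  simp only [hresp]
  have hspec := fun δ (hδ : δ < μ) => hH _ _ (hΨ δ (V O)) (hO δ hδ)
  refine ⟨fun δ hδ => ⟨(hspec δ hδ).2.1, (hspec δ hδ).2.2.1⟩, ?_,
    Set.eq_univ_of_forall fun x => ?_⟩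
  · rintro B ⟨δ, hδ, hB⟩
    exact (hspec δ hδ).1 B hB
  · obtain ⟨δ, hδ, hx⟩ := hwin (V O) (fun δ hδ => by
      rw [hV O δ]
      exact ⟨isOpen_sUnion (hspec δ hδ).1, (hspec δ hδ).2.2.2⟩) x
    rw [hV O δ] at hx
    obtain ⟨B, hB, hx⟩ := hx
    exact ⟨B, ⟨δ, hδ, hB⟩, hx⟩

theorem TwoWinsG1.gameDim_le {X : Type u} [TopologicalSpace X]
    [TopologicalSpace.MetrizableSpace X] [TopologicalSpace.SeparableSpace X] {α μ : Ordinal.{u}}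
    (h : TwoWinsG1 (fdCovers X) (openCovers X) α) (hμ : Order.IsSuccLimit μ) (hαμ : α ≤ μ) :
    gameDim X ≤ μ := by
  obtain ⟨Φ, hΦ, hloc, hwin⟩ := h.exists_finiteDim_strategy
  obtain ⟨Ψ, hΨ, hloc', hwin'⟩ := exists_disjointlyCoverable_strategy hμ hαμ hΦ hloc hwin
  exact (Ordinal.sub_le_self _ _).trans
    (csInf_le' (twoWinsGc_of_disjointlyCoverable_strategy hΨ hloc' hwin'))

theorem fdCovers_subset_kfdCovers (X : Type u) [TopologicalSpace X] :
    fdCovers X ⊆ kfdCovers X :=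
  fun _ h => ⟨h.1, fun T hT => h.2 T hT.2⟩

theorem TwoWinsG1.mono {X : Type u} {𝒜 𝒜' ℬ : Set (Set (Set X))} {α : Ordinal.{u}}
    (h : TwoWinsG1 𝒜' ℬ α) (h𝒜 : 𝒜 ⊆ 𝒜') : TwoWinsG1 𝒜 ℬ α :=
  h.imp fun _ hF O hO => hF O fun γ hγ => h𝒜 (hO γ hγ)

end Game

end GameDimension

theorem mainTheorem3 (X : Type u) [TopologicalSpace X] [TopologicalSpace.MetrizableSpace X]
    [TopologicalSpace.SeparableSpace X] (hX : ¬ GameDimension.FiniteDim X) :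
    ((Order.IsSuccLimit
          (GameDimension.tpS1 (GameDimension.fdCovers X) (GameDimension.openCovers X)) →
        GameDimension.gameDim X ≤
          GameDimension.tpS1 (GameDimension.fdCovers X) (GameDimension.openCovers X)) ∧
      (¬ Order.IsSuccLimit
          (GameDimension.tpS1 (GameDimension.fdCovers X) (GameDimension.openCovers X)) →
        GameDimension.gameDim X ≤
          GameDimension.tpS1 (GameDimension.fdCovers X) (GameDimension.openCovers X) +
            Ordinal.omega0)) ∧
    ((Order.IsSuccLimit
          (GameDimension.tpS1 (GameDimension.kfdCovers X) (GameDimension.openCovers X)) →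
        GameDimension.gameDim X ≤
          GameDimension.tpS1 (GameDimension.kfdCovers X) (GameDimension.openCovers X)) ∧
      (¬ Order.IsSuccLimit
          (GameDimension.tpS1 (GameDimension.kfdCovers X) (GameDimension.openCovers X)) →
        GameDimension.gameDim X ≤
          GameDimension.tpS1 (GameDimension.kfdCovers X) (GameDimension.openCovers X) +
            Ordinal.omega0)) := by
  have hlim (α : Ordinal.{u}) : Order.IsSuccLimit (α + Ordinal.omega0) :=
    Ordinal.isSuccLimit_add α Ordinal.isSuccLimit_omega0
  have hfd := GameDimension.twoWinsG1_tpS1 (X := X) (𝒜 := GameDimension.fdCovers X)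
    fun _ h => h.1
  have hkfd := (GameDimension.twoWinsG1_tpS1 (X := X) (𝒜 := GameDimension.kfdCovers X)
    fun _ h => h.1).mono (GameDimension.fdCovers_subset_kfdCovers X)
  exact ⟨⟨fun h => hfd.gameDim_le h le_rfl, fun _ => hfd.gameDim_le (hlim _) le_self_add⟩,
    ⟨fun h => hkfd.gameDim_le h le_rfl, fun _ => hkfd.gameDim_le (hlim _) le_self_add⟩⟩
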